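/- Throughout, quantum systems $A,B,A',B'$ are finite-dimensional complex Hilbert spaces, $AB$ denotes the tensor product of $A$ and $B$, $K\le L$ means that $L-K$ is positive semidefinite, and logarithms are taken to a fixed base $b>1$ ($\log 0=-\infty$). Definitions. $\mathcal S_\bullet(A)$ is the set of positive semidefinite operators $\rho$ on $A$ with $\operatorname{tr}\rho\le 1$. For positive semidefinite $\rho,\tau$ the fidelity is $F(\rho,\tau)=\big(\operatorname{tr}|\sqrt\rho\sqrt\tau|\big)^2$; for $\rho,\tau\in\mathcal S_\bullet(A)$ the generalized fidelity is $F_*(\rho,\tau)=\big(\operatorname{tr}|\sqrt\rho\sqrt\tau|+\sqrt{(1-\operatorname{tr}\rho)(1-\operatorname{tr}\tau)}\big)^2$ and the purified distance is $P(\rho,\tau)=\sqrt{1-F_*(\rho,\tau)}$. For $\rho_{AB}\in\mathcal S_\bullet(AB)$ the conditional min- and max-entropies are $$H_{\min}(A|B)_\rho=\sup_{\sigma_B\in\mathcal S_\bullet(B)}\sup\{\lambda\in\mathbb R:\rho_{AB}\le b^{-\lambda}\,\mathrm{id}_A\otimes\sigma_B\},\qquad H_{\max}(A|B)_\rho=\sup_{\sigma_B\in\mathcal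 S_\bullet(B)}\log F(\rho_{AB},\mathrm{id}_A\otimes\sigma_B),$$ where $\sup\emptyset=-\infty$. For $\varepsilon\ge0$ their smooth versions $H^\varepsilon_{\min}(A|B)_\rho$ and $H^\varepsilon_{\max}(A|B)_\rho$ are, respectively, the supremum of $H_{\min}(A|B)_{\tilde\rho}$ and the infimum of $H_{\max}(A|B)_{\tilde\rho}$ over all $\tilde\rho_{AB}\in\mathcal S_\bullet(AB)$ with $P(\tilde\rho,\rho)\le\varepsilon$. A linear map $\mathcal E$ from operators on $A$ to operators on $A'$ is CPTP if it preserves the trace and $\mathcal E\otimes\mathrm{id}_C$ maps positive semidefinite operators to positive semidefinite operators for every finite-dimensional $C$; it is sub-unital if $\mathcal E(\mathrm{id}_A)\le\mathrm{id}_{A'}$. Theorem. Let $\rho_{AB}\in\mathcal S_\bullet(AB)$ and $0\le\varepsilon<\sqrt{\operatorname{tr}\rho}$. Let $\mathcal E$ be a sub-unital CPTP map from $A$ to $A'$ and let $\mathcal F$ be a CPTP map from $B$ to $B'$. Then $\tau_{A'B'}=(\mathcal E\otimes\mathcal F)(\rho_{AB})$ satisfies $$H^\varepsilon_{\min}(A|B)_\rho\le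 H^\varepsilon_{\min}(A'|B')_\tau\qquad\text{and}\qquad H^\varepsilon_{\max}(A|B)_\rho\le H^\varepsilon_{\max}(A'|B')_\tau .$$ -/

import Mathlib

/-!
Finite-dimensional quantum systems are modelled by finite index types: a system `A` is the Hilbert
space `ℂ^A`, operators on it (equivalently, functionals) are matrices `Matrix A A ℂ`, and the joint
system `AB` is `A × B` with the Kronecker product `⊗ₖ`.  The order on matrices is the
positive-semidefinite (Loewner) order.
-/

open scoped Kronecker MatrixOrder ComplexOrder

noncomputable section

namespace SmoothEntropy

universe u v w x

/-- Sub-normalized density operators: positive semidefinite with trace at most one. -/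
def subStates (A : Type u) [Fintype A] : Set (Matrix A A ℂ) :=
  {ρ | ρ.PosSemidef ∧ ρ.trace.re ≤ 1}

/-- The trace norm `tr |X|`, with `|X| = √(X† X)`. -/
def traceNorm {A : Type u} [Fintype A] [DecidableEq A] (X : Matrix A A ℂ) : ℝ :=
  (CFC.abs X).trace.re

/-- The fidelity `(tr |√ρ √τ|)²` of two positive semidefinite operators. -/
def fidelity {A : Type u} [Fintype A] [DecidableEq A] (ρ τ : Matrix A A ℂ) : ℝ :=
  traceNorm (CFC.sqrt ρ * CFC.sqrt τ) ^ 2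

/-- The generalized fidelity of two sub-normalized density operators. -/
def genFidelity {A : Type u} [Fintype A] [DecidableEq A] (ρ τ : Matrix A A ℂ) : ℝ :=
  (traceNorm (CFC.sqrt ρ * CFC.sqrt τ)
    + Real.sqrt ((1 - ρ.trace.re) * (1 - τ.trace.re))) ^ 2

/-- The purified distance of two sub-normalized density operators. -/
def purifiedDist {A : Type u} [Fintype A] [DecidableEq A] (ρ τ : Matrix A A ℂ) : ℝ :=
  Real.sqrt (1 - genFidelity ρ τ)

/-- The `ε`-ball of sub-normalized density operators around `ρ` in purified distance. -/
def ball {A : Type u} [Fintype A] [DecidableEq A] (ε : ℝ) (ρ : Matrix A A ℂ) :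
    Set (Matrix A A ℂ) :=
  {τ | τ ∈ subStates A ∧ purifiedDist τ ρ ≤ ε}

/-- The logarithm to base `b` of a nonnegative real, with `log 0 = -∞`. -/
def elogb (b t : ℝ) : EReal :=
  if t = 0 then ⊥ else ((Real.logb b t : ℝ) : EReal)

/-- The min-entropy `H_min(A|B)_ρ`, with logarithms and exponentials to base `b`:
the supremum over sub-normalized `σ` on `B` of `sup {l : ℝ | ρ ≤ b ^ (-l) (1 ⊗ σ)}`. The inner
supremum is `-∞` if there is no such `l`. -/
def minEntropy {A : Type u} {B : Type v} [Fintype A] [DecidableEq A] [Fintype B]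
    (b : ℝ) (ρ : Matrix (A × B) (A × B) ℂ) : EReal :=
  ⨆ σ ∈ subStates B,
    sSup ((fun l : ℝ => (l : EReal)) ''
      {l : ℝ | ρ ≤ (b ^ (-l) : ℝ) • ((1 : Matrix A A ℂ) ⊗ₖ σ)})

/-- The max-entropy `H_max(A|B)_ρ`, with logarithms to base `b`. -/
def maxEntropy {A : Type u} {B : Type v} [Fintype A] [DecidableEq A] [Fintype B] [DecidableEq B]
    (b : ℝ) (ρ : Matrix (A × B) (A × B) ℂ) : EReal :=
  ⨆ σ ∈ subStates B, elogb b (fidelity ρ ((1 : Matrix A A ℂ) ⊗ₖ σ))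

/-- The smooth min-entropy. -/
def smoothMinEntropy {A : Type u} {B : Type v} [Fintype A] [DecidableEq A] [Fintype B]
    [DecidableEq B] (b ε : ℝ) (ρ : Matrix (A × B) (A × B) ℂ) : EReal :=
  ⨆ ρ' ∈ ball ε ρ, minEntropy b ρ'

/-- The smooth max-entropy. -/
def smoothMaxEntropy {A : Type u} {B : Type v} [Fintype A] [DecidableEq A] [Fintype B]
    [DecidableEq B] (b ε : ℝ) (ρ : Matrix (A × B) (A × B) ℂ) : EReal :=
  ⨅ ρ' ∈ ball ε ρ, maxEntropy b ρ'

/-- The tensor product `E ⊗ F` of two linear maps on operators, the linear map with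
`(E ⊗ F)(X ⊗ Y) = E X ⊗ F Y` (see `tensorMap_kronecker`), written out on matrix units. -/
def tensorMap {A : Type u} {B : Type v} {A' : Type w} {B' : Type x}
    [Fintype A] [DecidableEq A] [Fintype B] [DecidableEq B]
    (E : Matrix A A ℂ →ₗ[ℂ] Matrix A' A' ℂ) (F : Matrix B B ℂ →ₗ[ℂ] Matrix B' B' ℂ) :
    Matrix (A × B) (A × B) ℂ →ₗ[ℂ] Matrix (A' × B') (A' × B') ℂ where
  toFun X := ∑ p : A × B, ∑ q : A × B,
    X p q • (E (Matrix.single p.1 q.1 1) ⊗ₖ F (Matrix.single p.2 q.2 1))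
  map_add' X Y := by
    simp only [Matrix.add_apply, add_smul, Finset.sum_add_distrib]
  map_smul' c X := by
    simp only [Matrix.smul_apply, smul_assoc, Finset.smul_sum, RingHom.id_apply]

theorem tensorMap_kronecker {A : Type u} {B : Type v} {A' : Type w} {B' : Type x}
    [Fintype A] [DecidableEq A] [Fintype B] [DecidableEq B]
    (E : Matrix A A ℂ →ₗ[ℂ] Matrix A' A' ℂ) (F : Matrix B B ℂ →ₗ[ℂ] Matrix B' B' ℂ)
    (X : Matrix A A ℂ) (Y : Matrix B B ℂ) :
    tensorMap E F (X ⊗ₖ Y) = E X ⊗ₖ F Y := by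
  have hX : E X = ∑ i, ∑ j, X i j • E (Matrix.single i j 1) := by
    conv_lhs => rw [Matrix.matrix_eq_sum_single X]
    simp only [map_sum]
    refine Finset.sum_congr rfl fun i _ => Finset.sum_congr rfl fun j _ => ?_
    rw [← map_smul, Matrix.smul_single, smul_eq_mul, mul_one]
  have hY : F Y = ∑ i, ∑ j, Y i j • F (Matrix.single i j 1) := by
    conv_lhs => rw [Matrix.matrix_eq_sum_single Y]
    simp only [map_sum]
    refine Finset.sum_congr rfl fun i _ => Finset.sum_congr rfl fun j _ => ?_
    rw [← map_smul, Matrix.smul_single, smul_eq_mul, mul_one]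
  ext ⟨i, k⟩ ⟨j, l⟩
  rw [Matrix.kronecker_apply, hX, hY]
  simp only [tensorMap, LinearMap.coe_mk, AddHom.coe_mk, Matrix.sum_apply, Matrix.smul_apply,
    Matrix.kronecker_apply, smul_eq_mul, Fintype.sum_prod_type, Finset.sum_mul, Finset.mul_sum]
  rw [Finset.sum_comm]
  refine Finset.sum_congr rfl fun y _ => ?_
  rw [Finset.sum_congr rfl fun x _ => Finset.sum_comm, Finset.sum_comm]
  refine Finset.sum_congr rfl fun d _ => Finset.sum_congr rfl fun x _ =>
    Finset.sum_congr rfl fun c _ => ?_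
  ring

/-- Complete positivity: for every (finite-dimensional) auxiliary system `C = ℂ^n`, the map
`E ⊗ id_C` sends positive semidefinite operators to positive semidefinite operators. -/
def IsCP {A : Type u} {A' : Type w} [Fintype A] [DecidableEq A] [Fintype A']
    (E : Matrix A A ℂ →ₗ[ℂ] Matrix A' A' ℂ) : Prop :=
  ∀ (n : ℕ) (ω : Matrix (A × Fin n) (A × Fin n) ℂ), ω.PosSemidef →
    (tensorMap E (LinearMap.id : Matrix (Fin n) (Fin n) ℂ →ₗ[ℂ] _) ω).PosSemidef

/-- Completely positive trace-preserving maps (quantum channels). -/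
def IsCPTP {A : Type u} {A' : Type w} [Fintype A] [DecidableEq A] [Fintype A']
    (E : Matrix A A ℂ →ₗ[ℂ] Matrix A' A' ℂ) : Prop :=
  IsCP E ∧ ∀ ξ : Matrix A A ℂ, (E ξ).trace = ξ.trace

/-- Sub-unital maps: `E(1) ≤ 1`. -/
def IsSubUnital {A : Type u} {A' : Type w} [Fintype A] [DecidableEq A] [Fintype A']
    [DecidableEq A'] (E : Matrix A A ℂ →ₗ[ℂ] Matrix A' A' ℂ) : Prop :=
  E 1 ≤ 1

end SmoothEntropy

end

open SmoothEntropy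

noncomputable section

namespace SmoothEntropy

open Matrix

/-! ### Contractions and Douglas factorization -/

section Contractions

variable {X Y Z : Type*} [Fintype X] [Fintype Y] [Fintype Z]

/-! Write Φ = E ⊗ F in Kraus form. Sub-unitality gives Φ(1 ⊗ σ) ≤ 1 ⊗ F(σ). For the min-entropy,
push the smoothing state and σ through Φ: the operator inequality survives, and purified distance
does not grow.

For the max-entropy the infimum forces the opposite direction: each τ' near Φ(ρ) must be lifted to
some ρ' near ρ whose fidelity with each σ is at most that of τ' with Φ(σ). This is
`exists_lift_krausMap`, an Uhlmann argument: factor τ' = TT†, rotate T by a contraction into optimal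
overlap with the Stinespring image of √ρ, and pull back along the adjoint of the isometry.

Purifications are replaced throughout by factorizations. If ρ = MM† and σ = NN†, the root fidelity
is the maximum of Re tr(M C N†) over contractions C (`re_trace_le_traceNorm_sqrt`,
`exists_contraction_traceNorm_sqrt_eq`). -/

theorem conj_le_conj {P Q : Matrix X X ℂ} (h : P ≤ Q) (K : Matrix Y X ℂ) :
    K * P * Kᴴ ≤ K * Q * Kᴴ := by
  rw [Matrix.le_iff] at h ⊢
  have := h.mul_mul_conjTranspose_same K
  rwa [Matrix.mul_sub, Matrix.sub_mul] at this

theorem zero_le_mul_conjTranspose (K : Matrix Y X ℂ) : 0 ≤ K * Kᴴ :=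
  Matrix.nonneg_iff_posSemidef.2 (posSemidef_self_mul_conjTranspose K)

theorem trace_re_mono {P Q : Matrix X X ℂ} (h : P ≤ Q) : P.trace.re ≤ Q.trace.re := by
  have := (Complex.le_def.1 (Matrix.le_iff.1 h).trace_nonneg).1
  rw [Matrix.trace_sub, Complex.sub_re, Complex.zero_re] at this
  linarith

/-- A matrix of operator norm at most one. -/
def IsContraction [DecidableEq X] (C : Matrix X Y ℂ) : Prop :=
  C * Cᴴ ≤ 1

theorem IsContraction.one [DecidableEq X] : IsContraction (1 : Matrix X X ℂ) := by
  simp [IsContraction]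

theorem IsContraction.mul [DecidableEq X] [DecidableEq Y] {C : Matrix X Y ℂ} {D : Matrix Y Z ℂ}
    (hC : IsContraction C) (hD : IsContraction D) : IsContraction (C * D) := by
  have h := conj_le_conj hD C
  rw [Matrix.mul_one] at h
  unfold IsContraction
  rw [Matrix.conjTranspose_mul]
  simp only [Matrix.mul_assoc] at h ⊢
  exact h.trans hC

/-- Conjugating the bound gives P² ≤ P for P = C†C, and 1 - P = (1 - P)² + (P - P²). -/
theorem IsContraction.conjTranspose [DecidableEq X] [DecidableEq Y] {C : Matrix X Y ℂ}
    (hC : IsContraction C) : IsContraction Cᴴ := by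
  unfold IsContraction
  rw [Matrix.conjTranspose_conjTranspose]
  set P := Cᴴ * C with hP
  have h1 : P * P ≤ P := by
    have h := conj_le_conj hC Cᴴ
    simpa [hP, Matrix.mul_assoc] using h
  have hH : Pᴴ = P := by simp [hP]
  have h2 : 0 ≤ (1 - P) * (1 - P) := by
    have := zero_le_mul_conjTranspose (1 - P)
    rwa [Matrix.conjTranspose_sub, Matrix.conjTranspose_one, hH] at this
  have h3 : 1 - P = (1 - P) * (1 - P) + (P - P * P) := by noncomm_ring
  rw [← sub_nonneg, h3]
  exact add_nonneg h2 (sub_nonneg.2 h1)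

theorem IsContraction.one_kronecker [DecidableEq X] [DecidableEq Z] {C : Matrix X Y ℂ}
    (hC : IsContraction C) : IsContraction ((1 : Matrix Z Z ℂ) ⊗ₖ C) := by
  unfold IsContraction
  rw [Matrix.conjTranspose_kronecker, ← Matrix.mul_kronecker_mul, Matrix.conjTranspose_one,
    Matrix.one_mul, ← Matrix.one_kronecker_one, Matrix.le_iff]
  have h := (Matrix.PosSemidef.one (n := Z) (R := ℂ)).kronecker (Matrix.le_iff.1 hC)
  convert h using 1
  ext ⟨i, k⟩ ⟨j, l⟩
  simp [mul_sub, Matrix.one_apply, Prod.ext_iff, ite_and]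
  split_ifs <;> rfl

/-- A Hermitian matrix has a Hermitian generalized inverse that commutes with it. -/
theorem exists_pseudoInverse [DecidableEq X] {S : Matrix X X ℂ} (hS : Sᴴ = S) :
    ∃ R : Matrix X X ℂ, Rᴴ = R ∧ S * R = R * S ∧ S * R * S = S := by
  have hSa : IsSelfAdjoint S := hS
  have hfin : (spectrum ℝ S).Finite := Matrix.finite_real_spectrum
  have hc : ∀ f : ℝ → ℝ, ContinuousOn f (spectrum ℝ S) := fun f => hfin.continuousOn f
  have hid : cfc (fun x : ℝ => x) S = S := cfc_id' ℝ S
  have h1 : S * cfc (fun x : ℝ => x⁻¹) S = cfc (fun x : ℝ => x * x⁻¹) S := by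
    rw [cfc_mul (fun x : ℝ => x) (fun x : ℝ => x⁻¹) S (hc _) (hc _), hid]
  have h2 : cfc (fun x : ℝ => x⁻¹) S * S = cfc (fun x : ℝ => x⁻¹ * x) S := by
    rw [cfc_mul (fun x : ℝ => x⁻¹) (fun x : ℝ => x) S (hc _) (hc _), hid]
  refine ⟨cfc (fun x : ℝ => x⁻¹) S, ?_, ?_, ?_⟩
  · exact (cfc_predicate (fun x : ℝ => x⁻¹) S : IsSelfAdjoint _)
  · rw [h1, h2]
    simp only [mul_comm]
  · have h3 : cfc (fun x : ℝ => x * x⁻¹) S * S = cfc (fun x : ℝ => x * x⁻¹ * x) S := by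
      rw [cfc_mul (fun x : ℝ => x * x⁻¹) (fun x : ℝ => x) S (hc _) (hc _), hid]
    rw [h1, h3]
    simp only [mul_inv_mul_cancel, hid]

/-- Douglas factorization with C = RM, R a generalized inverse of S. The projection 1 - SR kills S,
hence by the bound also M. -/
theorem exists_contraction_of_le_sq [DecidableEq X] {S : Matrix X X ℂ} (hS : Sᴴ = S)
    {M : Matrix X Y ℂ} (h : M * Mᴴ ≤ S * S) :
    ∃ C : Matrix X Y ℂ, IsContraction C ∧ M = S * C ∧ (M * Mᴴ = S * S → S = M * Cᴴ) := by
  obtain ⟨R, hR, hcomm, hSRS⟩ := exists_pseudoInverse hS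
  have hH : (1 - S * R)ᴴ = 1 - S * R := by
    rw [Matrix.conjTranspose_sub, Matrix.conjTranspose_mul, hR, hS, Matrix.conjTranspose_one,
      hcomm]
  have hQS : (1 - S * R) * S = 0 := by rw [Matrix.sub_mul, hSRS, Matrix.one_mul, sub_self]
  have hQM : (1 - S * R) * M = 0 := by
    rw [← Matrix.self_mul_conjTranspose_eq_zero]
    refine le_antisymm ?_ (zero_le_mul_conjTranspose _)
    have := conj_le_conj h (1 - S * R)
    rw [← Matrix.mul_assoc (1 - S * R) S S, hQS, Matrix.zero_mul, Matrix.zero_mul] at this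
    rwa [Matrix.conjTranspose_mul, Matrix.mul_assoc, ← Matrix.mul_assoc M, ← Matrix.mul_assoc]
  refine ⟨R * M, ?_, ?_, fun heq => ?_⟩
  · unfold IsContraction
    have h1 := conj_le_conj h R
    have h2 : R * (S * S) * Rᴴ = S * R := by
      rw [hR, ← Matrix.mul_assoc, ← hcomm, hSRS]
    have h3 : 0 ≤ 1 - S * R := by
      have := zero_le_mul_conjTranspose (1 - S * R)
      rwa [hH, Matrix.mul_sub, ← Matrix.mul_assoc, hQS, Matrix.zero_mul, Matrix.mul_one,
        sub_zero] at this
    rw [h2] at h1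
    rw [Matrix.conjTranspose_mul, Matrix.mul_assoc, ← Matrix.mul_assoc M, ← Matrix.mul_assoc]
    exact h1.trans (sub_nonneg.1 h3)
  · rw [Matrix.sub_mul, Matrix.one_mul, sub_eq_zero] at hQM
    rw [← Matrix.mul_assoc]
    exact hQM
  · rw [Matrix.conjTranspose_mul, ← Matrix.mul_assoc, heq, hR, Matrix.mul_assoc, hcomm,
      ← Matrix.mul_assoc, hSRS]

end Contractions

/-! ### Trace norm duality and fidelity as an optimal overlap -/

section TraceNorm

theorem conjTranspose_of_nonneg {X : Type*} {P : Matrix X X ℂ} (h : 0 ≤ P) : Pᴴ = P :=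
  (Matrix.nonneg_iff_posSemidef.1 h).isHermitian

theorem re_trace_conjTranspose {X : Type*} [Fintype X] (P : Matrix X X ℂ) :
    Pᴴ.trace.re = P.trace.re := by
  rw [Matrix.trace_conjTranspose]
  simp

variable {X Y Z : Type*} [Fintype X] [DecidableEq X] [Fintype Y] [DecidableEq Y] [Fintype Z]

theorem conjTranspose_sqrt (P : Matrix X X ℂ) : (CFC.sqrt P)ᴴ = CFC.sqrt P :=
  conjTranspose_of_nonneg (CFC.sqrt_nonneg P)

/-- Pair P with 2 - G - G† = (1 - G)(1 - G)† + (1 - GG†) ≥ 0. -/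
theorem re_trace_contraction_mul_le {G P : Matrix X X ℂ} (hG : IsContraction G) (hP : 0 ≤ P) :
    (G * P).trace.re ≤ P.trace.re := by
  have h0 : 0 ≤ (1 - G) * (1 - G)ᴴ + (1 - G * Gᴴ) :=
    add_nonneg (zero_le_mul_conjTranspose _) (sub_nonneg.2 hG)
  set S := CFC.sqrt P with hS
  have hSS : S * S = P := CFC.sqrt_mul_sqrt_self P hP
  have hSH : Sᴴ = S := conjTranspose_sqrt P
  have h1 := trace_re_mono (conj_le_conj h0 S)
  have h2 : (S * ((1 - G) * (1 - G)ᴴ + (1 - G * Gᴴ)) * Sᴴ).trace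
      = 2 * P.trace - (G * P).trace - (P * Gᴴ).trace := by
    rw [Matrix.trace_mul_comm, ← Matrix.mul_assoc, hSH, hSS]
    have : P * ((1 - G) * (1 - G)ᴴ + (1 - G * Gᴴ)) = P + P - P * G - P * Gᴴ := by
      rw [Matrix.conjTranspose_sub, Matrix.conjTranspose_one]
      noncomm_ring
    rw [this, Matrix.trace_sub, Matrix.trace_sub, Matrix.trace_add, Matrix.trace_mul_comm P G]
    ring
  have h3 : (P * Gᴴ).trace.re = (G * P).trace.re := by
    rw [← re_trace_conjTranspose (G * P), Matrix.conjTranspose_mul, conjTranspose_of_nonneg hP]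
  rw [h2] at h1
  simp only [Matrix.mul_zero, Matrix.zero_mul, Matrix.trace_zero, Complex.zero_re, Complex.sub_re,
    Complex.mul_re, Complex.re_ofNat, Complex.im_ofNat] at h1
  linarith

theorem traceNorm_nonneg (T : Matrix X X ℂ) : 0 ≤ traceNorm T :=
  (Complex.le_def.1 (Matrix.nonneg_iff_posSemidef.1 (CFC.abs_nonneg T)).trace_nonneg).1

/-- Since T†T = |T|², Douglas factorization of T† through |T| yields a polar decomposition; a
contraction suffices in place of a unitary. -/
theorem exists_polar (T : Matrix X X ℂ) :
    ∃ D : Matrix X X ℂ, IsContraction D ∧ T = D * CFC.abs T ∧ CFC.abs T = Dᴴ * T := by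
  have hH : (CFC.abs T)ᴴ = CFC.abs T := conjTranspose_of_nonneg (CFC.abs_nonneg T)
  have h : Tᴴ * Tᴴᴴ = CFC.abs T * CFC.abs T := by
    rw [Matrix.conjTranspose_conjTranspose, CFC.abs_mul_abs]
    rfl
  obtain ⟨C, hC, h1, h2⟩ := exists_contraction_of_le_sq hH h.le
  refine ⟨Cᴴ, hC.conjTranspose, ?_, ?_⟩
  · rw [← hH, ← Matrix.conjTranspose_mul, ← h1, Matrix.conjTranspose_conjTranspose]
  · rw [Matrix.conjTranspose_conjTranspose, ← hH, h2 h, Matrix.conjTranspose_mul,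
      Matrix.conjTranspose_conjTranspose, Matrix.conjTranspose_conjTranspose]

theorem re_trace_mul_contraction_le_traceNorm (T : Matrix X X ℂ) {C : Matrix X X ℂ}
    (hC : IsContraction C) : (T * C).trace.re ≤ traceNorm T := by
  obtain ⟨D, hD, h1, -⟩ := exists_polar T
  have : (T * C).trace = (C * D * CFC.abs T).trace := by
    conv_lhs => rw [h1]
    rw [Matrix.trace_mul_comm, Matrix.mul_assoc]
  rw [this]
  exact re_trace_contraction_mul_le (hC.mul hD) (CFC.abs_nonneg T)

theorem exists_contraction_traceNorm_eq (T : Matrix X X ℂ) :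
    ∃ C : Matrix X X ℂ, IsContraction C ∧ traceNorm T = (T * C).trace.re := by
  obtain ⟨D, hD, -, h2⟩ := exists_polar T
  exact ⟨Dᴴ, hD.conjTranspose, by rw [traceNorm, h2, Matrix.trace_mul_comm]⟩

/-- Every overlap of two factorizations bounds the root fidelity from below. -/
theorem re_trace_le_traceNorm_sqrt [DecidableEq Z] {ρ σ : Matrix X X ℂ} {M : Matrix X Y ℂ} {N : Matrix X Z ℂ}
    (hM : M * Mᴴ ≤ ρ) (hN : N * Nᴴ ≤ σ) {C : Matrix Y Z ℂ} (hC : IsContraction C) :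
    (M * C * Nᴴ).trace.re ≤ traceNorm (CFC.sqrt ρ * CFC.sqrt σ) := by
  have hρ : CFC.sqrt ρ * CFC.sqrt ρ = ρ :=
    CFC.sqrt_mul_sqrt_self ρ ((zero_le_mul_conjTranspose M).trans hM)
  have hσ : CFC.sqrt σ * CFC.sqrt σ = σ :=
    CFC.sqrt_mul_sqrt_self σ ((zero_le_mul_conjTranspose N).trans hN)
  obtain ⟨D, hD, h1, -⟩ := exists_contraction_of_le_sq (conjTranspose_sqrt ρ) (hM.trans hρ.ge)
  obtain ⟨D', hD', h2, -⟩ := exists_contraction_of_le_sq (conjTranspose_sqrt σ) (hN.trans hσ.ge)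
  refine le_of_eq_of_le ?_ (re_trace_mul_contraction_le_traceNorm
    (CFC.sqrt ρ * CFC.sqrt σ) ((hD.mul hC).mul hD'.conjTranspose).conjTranspose)
  rw [← re_trace_conjTranspose]
  conv_lhs => rw [h1, h2]
  simp only [Matrix.conjTranspose_mul, Matrix.conjTranspose_conjTranspose, conjTranspose_sqrt,
    ← Matrix.mul_assoc]
  rw [Matrix.trace_mul_comm _ (CFC.sqrt ρ)]
  simp only [Matrix.mul_assoc]

/-- For fixed factorizations, the root fidelity is attained as an overlap. -/
theorem exists_contraction_traceNorm_sqrt_eq {ρ σ : Matrix X X ℂ} {M : Matrix X Y ℂ}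
    {N : Matrix X Z ℂ} (hM : M * Mᴴ = ρ) (hN : N * Nᴴ = σ) :
    ∃ C : Matrix Y Z ℂ, IsContraction C ∧
      traceNorm (CFC.sqrt ρ * CFC.sqrt σ) = (M * C * Nᴴ).trace.re := by
  have hρ : CFC.sqrt ρ * CFC.sqrt ρ = ρ :=
    CFC.sqrt_mul_sqrt_self ρ ((zero_le_mul_conjTranspose M).trans hM.le)
  have hσ : CFC.sqrt σ * CFC.sqrt σ = σ :=
    CFC.sqrt_mul_sqrt_self σ ((zero_le_mul_conjTranspose N).trans hN.le)
  obtain ⟨D, hD, -, h1⟩ :=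
    exists_contraction_of_le_sq (conjTranspose_sqrt ρ) (hM.trans hρ.symm).le
  obtain ⟨D', hD', -, h2⟩ :=
    exists_contraction_of_le_sq (conjTranspose_sqrt σ) (hN.trans hσ.symm).le
  replace h1 := h1 (hM.trans hρ.symm)
  replace h2 := h2 (hN.trans hσ.symm)
  obtain ⟨C, hC, h⟩ := exists_contraction_traceNorm_eq (CFC.sqrt ρ * CFC.sqrt σ)
  refine ⟨Dᴴ * Cᴴ * D', (hD.conjTranspose.mul hC.conjTranspose).mul hD', ?_⟩
  have h2' : CFC.sqrt σ = D' * Nᴴ := by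
    rw [← conjTranspose_sqrt, h2, Matrix.conjTranspose_mul, Matrix.conjTranspose_conjTranspose]
  have e : M * (Dᴴ * Cᴴ * D') * Nᴴ = CFC.sqrt ρ * Cᴴ * CFC.sqrt σ := by
    rw [h2', h1]
    simp only [Matrix.mul_assoc]
  rw [h, e, ← re_trace_conjTranspose, Matrix.conjTranspose_mul, Matrix.conjTranspose_mul,
    conjTranspose_sqrt, conjTranspose_sqrt, ← Matrix.mul_assoc, Matrix.trace_mul_comm,
    ← Matrix.mul_assoc]

end TraceNorm

/-! ### Kraus representations and tensor products -/

section Kraus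

variable {X Y ι : Type*} [Fintype X] [Fintype ι]

/-- The completely positive map with Kraus operators `K`. -/
def krausMap (K : ι → Matrix Y X ℂ) : Matrix X X ℂ →ₗ[ℂ] Matrix Y Y ℂ where
  toFun ξ := ∑ i, K i * ξ * (K i)ᴴ
  map_add' ξ η := by simp only [Matrix.mul_add, Matrix.add_mul, Finset.sum_add_distrib]
  map_smul' c ξ := by simp [Finset.smul_sum]

theorem krausMap_apply (K : ι → Matrix Y X ℂ) (ξ : Matrix X X ℂ) :
    krausMap K ξ = ∑ i, K i * ξ * (K i)ᴴ := rfl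

theorem krausMap_mono [Fintype Y] (K : ι → Matrix Y X ℂ) {P Q : Matrix X X ℂ} (h : P ≤ Q) :
    krausMap K P ≤ krausMap K Q :=
  Finset.sum_le_sum fun i _ => conj_le_conj h (K i)

theorem sum_conjTranspose_mul_eq_one [Fintype Y] [DecidableEq X] {K : ι → Matrix Y X ℂ}
    (hK : ∀ ξ, (krausMap K ξ).trace = ξ.trace) : ∑ i, (K i)ᴴ * K i = 1 := by
  rw [Matrix.ext_iff_trace_mul_left]
  intro ξ
  rw [Matrix.mul_one, ← hK ξ, krausMap_apply, Matrix.mul_sum, Matrix.trace_sum, Matrix.trace_sum]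
  refine Finset.sum_congr rfl fun i _ => ?_
  rw [Matrix.mul_assoc, Matrix.trace_mul_comm (K i), Matrix.mul_assoc]

/-- Choi's theorem: the columns of the square root of the Choi matrix, reshaped, are the Kraus
operators. -/
theorem exists_krausMap_eq [DecidableEq X] [Fintype Y] [DecidableEq Y] {E : Matrix X X ℂ →ₗ[ℂ] Matrix Y Y ℂ}
    (hE : IsCP E) : ∃ K : Y × Fin (Fintype.card X) → Matrix Y X ℂ, E = krausMap K := by
  -- `IsCP` only tests auxiliary systems `Fin n`, so `v`, the unnormalized maximally entangled
  -- vector, needs a relabelled copy of `X`.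
  let e := Fintype.equivFin X
  let v : X × Fin (Fintype.card X) → ℂ := fun p => if e p.1 = p.2 then 1 else 0
  have hJ := hE _ (vecMulVec v (star v)) (posSemidef_vecMulVec_self_star v)
  set J := tensorMap E (LinearMap.id : Matrix (Fin (Fintype.card X)) _ ℂ →ₗ[ℂ] _)
    (vecMulVec v (star v)) with hJdef
  have hentry : ∀ a b a' b', E (Matrix.single a b 1) a' b' = J (a', e a) (b', e b) := by
    intro a b a' b'
    simp only [hJdef, tensorMap, LinearMap.coe_mk, AddHom.coe_mk, Matrix.sum_apply,
      Matrix.smul_apply, Matrix.kronecker_apply, LinearMap.id_apply, Fintype.sum_prod_type]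
    have h1 : ∀ (x y : X) (k l : Fin (Fintype.card X)),
        vecMulVec v (star v) (x, k) (y, l) • (E (Matrix.single x y 1) a' b' *
          Matrix.single k l (1 : ℂ) (e a) (e b))
        = if k = e a then if l = e b then if x = a then if y = b then
            E (Matrix.single a b 1) a' b' else 0 else 0 else 0 else 0 := by
      intro x y k l
      by_cases hk : k = e a
      · by_cases hl : l = e b
        · subst hk hl
          by_cases hx : x = a
          · by_cases hy : y = b
            · subst hx hy
              simp [v, vecMulVec_apply]
            · simp [v, vecMulVec_apply, hy]
          · simp [v, vecMulVec_apply, hx]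
        · simp [hl]
      · simp [hk]
    simp only [h1]
    simp
  have hSS : CFC.sqrt J * (CFC.sqrt J)ᴴ = J := by
    rw [conjTranspose_sqrt, CFC.sqrt_mul_sqrt_self J (Matrix.nonneg_iff_posSemidef.2 hJ)]
  have hsum : ∀ p q, J p q = ∑ c, CFC.sqrt J p c * (CFC.sqrt J)ᴴ c q := fun p q => by
    rw [← Matrix.mul_apply, hSS]
  refine ⟨fun c => Matrix.of fun a' a => CFC.sqrt J (a', e a) c, ?_⟩
  refine Matrix.ext_linearMap ℂ fun a b => LinearMap.ext fun t => ?_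
  have ht : Matrix.single a b t = t • Matrix.single a b (1 : ℂ) := by simp
  change E (Matrix.single a b t) = krausMap _ (Matrix.single a b t)
  rw [ht, map_smul, map_smul]
  congr 1
  ext a' b'
  rw [hentry, hsum, krausMap_apply, Matrix.sum_apply]
  refine Finset.sum_congr rfl fun c _ => ?_
  simp [Matrix.mul_apply, Matrix.single_apply, ite_and]

variable {A B A' B' κ : Type*} [Fintype A] [DecidableEq A] [Fintype B] [DecidableEq B]
  [Fintype κ]

/-- Linear maps on operators of a joint system agree if they agree on products. -/
theorem ext_kronecker {V : Type*} [AddCommMonoid V] [Module ℂ V]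
    {f g : Matrix (A × B) (A × B) ℂ →ₗ[ℂ] V}
    (h : ∀ (P : Matrix A A ℂ) (Q : Matrix B B ℂ), f (P ⊗ₖ Q) = g (P ⊗ₖ Q)) : f = g := by
  refine Matrix.ext_linearMap ℂ fun p q => LinearMap.ext fun t => ?_
  have ht : Matrix.single p q t = Matrix.single p.1 q.1 t ⊗ₖ Matrix.single p.2 q.2 (1 : ℂ) := by
    rw [Matrix.single_kronecker_single, mul_one]
  change f (Matrix.single p q t) = g (Matrix.single p q t)
  rw [ht, h]

theorem tensorMap_krausMap (K : ι → Matrix A' A ℂ) (L : κ → Matrix B' B ℂ) :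
    tensorMap (krausMap K) (krausMap L)
      = krausMap fun p : ι × κ => K p.1 ⊗ₖ L p.2 := by
  refine ext_kronecker fun P Q => ?_
  rw [tensorMap_kronecker]
  simp only [krausMap_apply, Fintype.sum_prod_type, Matrix.conjTranspose_kronecker,
    ← Matrix.mul_kronecker_mul]
  ext ⟨i, k⟩ ⟨j, l⟩
  simp only [Matrix.kronecker_apply, Matrix.sum_apply, Finset.sum_mul_sum]

theorem trace_tensorMap [Fintype A'] [Fintype B'] {E : Matrix A A ℂ →ₗ[ℂ] Matrix A' A' ℂ}
    {F : Matrix B B ℂ →ₗ[ℂ] Matrix B' B' ℂ} (hE : ∀ ξ, (E ξ).trace = ξ.trace)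
    (hF : ∀ ξ, (F ξ).trace = ξ.trace) (ξ : Matrix (A × B) (A × B) ℂ) :
    (tensorMap E F ξ).trace = ξ.trace := by
  have : Matrix.traceLinearMap (A' × B') ℂ ℂ ∘ₗ tensorMap E F
      = Matrix.traceLinearMap (A × B) ℂ ℂ := by
    refine ext_kronecker fun P Q => ?_
    simp only [LinearMap.comp_apply, Matrix.traceLinearMap_apply, tensorMap_kronecker,
      Matrix.trace_kronecker, hE, hF]
  exact LinearMap.congr_fun this ξ

end Kraus

/-! ### Block rows as Stinespring dilations -/

section Blocks

variable {X Y Z W ι : Type*}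

/-- The block row with blocks `G i`. -/
def blockRow (G : ι → Matrix X Z ℂ) : Matrix X (ι × Z) ℂ :=
  Matrix.of fun x p => G p.1 x p.2

theorem exists_blockRow_eq (T : Matrix X (ι × Z) ℂ) : ∃ G, blockRow G = T :=
  ⟨fun i => Matrix.of fun x z => T x (i, z), rfl⟩

theorem blockRow_mul_conjTranspose [Fintype Z] [Fintype ι] (G : ι → Matrix X Z ℂ) (H : ι → Matrix Y Z ℂ) :
    blockRow G * (blockRow H)ᴴ = ∑ i, G i * (H i)ᴴ := by
  ext x y
  simp [blockRow, Matrix.mul_apply, Matrix.sum_apply, Fintype.sum_prod_type]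

theorem blockRow_mul_one_kronecker [Fintype Z] [Fintype ι] [DecidableEq ι] (G : ι → Matrix X Z ℂ) (C : Matrix Z W ℂ) :
    blockRow G * ((1 : Matrix ι ι ℂ) ⊗ₖ C) = blockRow fun i => G i * C := by
  ext x ⟨i, w⟩
  simp only [blockRow, Matrix.mul_apply, Fintype.sum_prod_type, Matrix.of_apply,
    Matrix.kronecker_apply, Matrix.one_apply]
  rw [Finset.sum_eq_single i]
  · simp
  · intro j _ hj
    simp [hj]
  · simp

/-- The block index plays the environment: a factorization of a state becomes one of its image. -/
theorem blockRow_mul_eq_krausMap [Fintype X] [Fintype Z] [Fintype ι] (K : ι → Matrix Y X ℂ) (M : Matrix X Z ℂ) :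
    blockRow (fun i => K i * M) * (blockRow fun i => K i * M)ᴴ = krausMap K (M * Mᴴ) := by
  rw [blockRow_mul_conjTranspose, krausMap_apply]
  simp only [Matrix.conjTranspose_mul, Matrix.mul_assoc]

end Blocks

/-! ### Monotonicity and lifting of fidelity -/

section Fidelity

variable {X Y ι : Type*} [Fintype X] [DecidableEq X] [Fintype Y] [DecidableEq Y] [Fintype ι]
  [DecidableEq ι]

theorem sqrt_mul_conjTranspose_sqrt {P : Matrix X X ℂ} (h : 0 ≤ P) :
    CFC.sqrt P * (CFC.sqrt P)ᴴ = P := by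
  rw [conjTranspose_sqrt, CFC.sqrt_mul_sqrt_self P h]

/-- A factor of σ stays admissible for σ', because the lower bound needs only NN† ≤ σ'. -/
theorem traceNorm_sqrt_mono_right {ρ σ σ' : Matrix X X ℂ} (hρ : 0 ≤ ρ) (hσ : 0 ≤ σ)
    (h : σ ≤ σ') :
    traceNorm (CFC.sqrt ρ * CFC.sqrt σ) ≤ traceNorm (CFC.sqrt ρ * CFC.sqrt σ') := by
  obtain ⟨C, hC, h1⟩ := exists_contraction_traceNorm_sqrt_eq (sqrt_mul_conjTranspose_sqrt hρ)
    (sqrt_mul_conjTranspose_sqrt hσ)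
  rw [h1]
  exact re_trace_le_traceNorm_sqrt (sqrt_mul_conjTranspose_sqrt hρ).le
    ((sqrt_mul_conjTranspose_sqrt hσ).trans_le h) hC

/-- The root fidelity does not decrease under a trace-preserving Kraus map. -/
theorem traceNorm_sqrt_le_krausMap {K : ι → Matrix Y X ℂ}
    (hK : ∀ ξ, (krausMap K ξ).trace = ξ.trace) {ρ σ : Matrix X X ℂ} (hρ : 0 ≤ ρ) (hσ : 0 ≤ σ) :
    traceNorm (CFC.sqrt ρ * CFC.sqrt σ)
      ≤ traceNorm (CFC.sqrt (krausMap K ρ) * CFC.sqrt (krausMap K σ)) := by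
  have h1 := sqrt_mul_conjTranspose_sqrt hρ
  have h2 := sqrt_mul_conjTranspose_sqrt hσ
  obtain ⟨C, hC, h⟩ := exists_contraction_traceNorm_sqrt_eq h1 h2
  set M := CFC.sqrt ρ
  set N := CFC.sqrt σ
  have h3 := blockRow_mul_eq_krausMap K M
  have h4 := blockRow_mul_eq_krausMap K N
  rw [h1] at h3
  rw [h2] at h4
  -- Acting by C on each block reproduces the original overlap, by trace preservation.
  refine le_of_eq_of_le ?_ (re_trace_le_traceNorm_sqrt h3.le h4.le (hC.one_kronecker (Z := ι)))
  rw [h, blockRow_mul_one_kronecker, blockRow_mul_conjTranspose, ← hK, krausMap_apply]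
  simp only [Matrix.conjTranspose_mul, Matrix.mul_assoc]

/-- Uhlmann-type lifting through a trace-preserving Kraus map `Φ`: a state `τ'` close to `Φ ρ`
lifts to a state `ρ'` as close to `ρ`, whose fidelities are dominated by those of `τ'`. -/
theorem exists_lift_krausMap {K : ι → Matrix Y X ℂ}
    (hK : ∀ ξ, (krausMap K ξ).trace = ξ.trace) {ρ : Matrix X X ℂ} (hρ : 0 ≤ ρ)
    {τ' : Matrix Y Y ℂ} (hτ' : 0 ≤ τ') :
    ∃ ρ' : Matrix X X ℂ, 0 ≤ ρ' ∧ ρ'.trace.re ≤ τ'.trace.re ∧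
      traceNorm (CFC.sqrt τ' * CFC.sqrt (krausMap K ρ))
        ≤ traceNorm (CFC.sqrt ρ' * CFC.sqrt ρ) ∧
      ∀ σ : Matrix X X ℂ, 0 ≤ σ → traceNorm (CFC.sqrt ρ' * CFC.sqrt σ)
        ≤ traceNorm (CFC.sqrt τ' * CFC.sqrt (krausMap K σ)) := by
  have hM := sqrt_mul_conjTranspose_sqrt hρ
  have hT := sqrt_mul_conjTranspose_sqrt hτ'
  have hMK := blockRow_mul_eq_krausMap K (CFC.sqrt ρ)
  rw [hM] at hMK
  obtain ⟨C, hC, hfid⟩ := exists_contraction_traceNorm_sqrt_eq hT hMK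
  set M := CFC.sqrt ρ
  set T := CFC.sqrt τ'
  obtain ⟨G, hG⟩ := exists_blockRow_eq (T * C)
  have hN : blockRow (fun i => (K i)ᴴ) * (blockRow fun i => (G i)ᴴ)ᴴ = ∑ i, (K i)ᴴ * G i := by
    simp only [blockRow_mul_conjTranspose, Matrix.conjTranspose_conjTranspose]
  have hKc : IsContraction (blockRow fun i => (K i)ᴴ) := by
    refine le_of_eq ?_
    simp only [blockRow_mul_conjTranspose, Matrix.conjTranspose_conjTranspose]
    exact sum_conjTranspose_mul_eq_one hK
  -- N is V†, the adjoint of the isometry stacking the K i, applied to the stacked blocks of TC; the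
  -- lift is NN†.
  set N := ∑ i, (K i)ᴴ * G i with hNdef
  refine ⟨N * Nᴴ, zero_le_mul_conjTranspose N, ?_, ?_, fun σ hσ => ?_⟩
  -- Neither V† nor C can increase the trace.
  · have h1 : (N * Nᴴ).trace.re ≤ (∑ i, (G i)ᴴ * G i).trace.re := by
      have h := trace_re_mono (conj_le_conj hKc.conjTranspose (blockRow fun i => (G i)ᴴ))
      rw [Matrix.mul_one, blockRow_mul_conjTranspose, Matrix.conjTranspose_conjTranspose] at h
      simp only [Matrix.conjTranspose_conjTranspose] at h
      rw [Matrix.trace_mul_comm, ← hN]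
      simpa only [Matrix.conjTranspose_mul, Matrix.conjTranspose_conjTranspose,
        Matrix.mul_assoc] using h
    have h2 : (∑ i, (G i)ᴴ * G i).trace = (T * (C * Cᴴ) * Tᴴ).trace := by
      have : T * (C * Cᴴ) * Tᴴ = ∑ i, G i * (G i)ᴴ := by
        rw [← blockRow_mul_conjTranspose, hG, Matrix.conjTranspose_mul]
        simp only [Matrix.mul_assoc]
      rw [this, Matrix.trace_sum, Matrix.trace_sum]
      exact Finset.sum_congr rfl fun i _ => Matrix.trace_mul_comm _ _
    have h3 := trace_re_mono (conj_le_conj hC T)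
    rw [Matrix.mul_one, hT] at h3
    exact (h1.trans_eq (congrArg Complex.re h2)).trans h3
  · refine le_of_eq_of_le ?_ (re_trace_le_traceNorm_sqrt le_rfl hM.le IsContraction.one)
    rw [hfid, ← hG, blockRow_mul_conjTranspose, Matrix.mul_one, hNdef, Matrix.sum_mul,
      Matrix.trace_sum, Matrix.trace_sum]
    congr 1
    refine Finset.sum_congr rfl fun i _ => ?_
    rw [Matrix.conjTranspose_mul, ← Matrix.mul_assoc, Matrix.trace_mul_comm, Matrix.mul_assoc]
  · have hL := sqrt_mul_conjTranspose_sqrt hσ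
    have hLK := blockRow_mul_eq_krausMap K (CFC.sqrt σ)
    rw [hL] at hLK
    obtain ⟨D, hD, hf⟩ := exists_contraction_traceNorm_sqrt_eq (rfl : N * Nᴴ = _) hL
    -- An optimal D for NN† and σ gives the competitor C(1 ⊗ D) for τ' and its image, with equal
    -- overlap.
    refine le_of_eq_of_le ?_ (re_trace_le_traceNorm_sqrt hT.le hLK.le
      (hC.mul (hD.one_kronecker (Z := ι))))
    rw [hf, ← Matrix.mul_assoc, ← hG, blockRow_mul_one_kronecker, blockRow_mul_conjTranspose,
      hNdef, Matrix.sum_mul, Matrix.sum_mul, Matrix.trace_sum, Matrix.trace_sum]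
    congr 1
    refine Finset.sum_congr rfl fun i _ => ?_
    rw [Matrix.conjTranspose_mul, ← Matrix.mul_assoc _ _ (K i)ᴴ, Matrix.trace_mul_comm _ (K i)ᴴ]
    simp only [Matrix.mul_assoc]

end Fidelity

/-! ### Purified distance and logarithm -/

section Entropy

variable {X Y : Type*} [Fintype X] [DecidableEq X] [Fintype Y] [DecidableEq Y]

/-- A smaller trace of τ only enlarges the deficit term of the generalized fidelity. -/
theorem purifiedDist_le_of_traceNorm_le {τ σ : Matrix Y Y ℂ} {ρ ω : Matrix X X ℂ}
    (h : traceNorm (CFC.sqrt ρ * CFC.sqrt ω) ≤ traceNorm (CFC.sqrt τ * CFC.sqrt σ))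
    (h1 : τ.trace.re ≤ ρ.trace.re) (h2 : σ.trace.re = ω.trace.re) (hω : ω.trace.re ≤ 1) :
    purifiedDist τ σ ≤ purifiedDist ρ ω := by
  unfold purifiedDist genFidelity
  have h0 := traceNorm_nonneg (CFC.sqrt ρ * CFC.sqrt ω)
  have h3 : (1 - ρ.trace.re) * (1 - ω.trace.re) ≤ (1 - τ.trace.re) * (1 - σ.trace.re) := by
    rw [h2]
    exact mul_le_mul_of_nonneg_right (by linarith) (by linarith)
  refine Real.sqrt_le_sqrt (sub_le_sub_left (pow_le_pow_left₀ (by positivity) ?_ 2) 1)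
  exact add_le_add h (Real.sqrt_le_sqrt h3)

theorem elogb_mono {b s t : ℝ} (hb : 1 < b) (hs : 0 ≤ s) (h : s ≤ t) :
    elogb b s ≤ elogb b t := by
  unfold elogb
  rcases hs.eq_or_lt with rfl | h0
  · simp
  · rw [if_neg h0.ne', if_neg (h0.trans_le h).ne']
    exact EReal.coe_le_coe_iff.2 (Real.logb_le_logb_of_le hb h0 h)

end Entropy

end SmoothEntropy

end

/-! ### The two entropy inequalities -/

theorem mainTheorem11 {A : Type*} {B : Type*} {A' : Type*} {B' : Type*}
    [Fintype A] [DecidableEq A] [Fintype B] [DecidableEq B]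
    [Fintype A'] [DecidableEq A'] [Fintype B'] [DecidableEq B']
    (b : ℝ) (hb : 1 < b)
    (ρ : Matrix (A × B) (A × B) ℂ) (hρ : ρ ∈ subStates (A × B))
    (ε : ℝ) (hε0 : 0 ≤ ε) (hε : ε < Real.sqrt ρ.trace.re)
    (E : Matrix A A ℂ →ₗ[ℂ] Matrix A' A' ℂ) (hE : IsCPTP E) (hE1 : IsSubUnital E)
    (F : Matrix B B ℂ →ₗ[ℂ] Matrix B' B' ℂ) (hF : IsCPTP F) :
    smoothMinEntropy b ε ρ ≤ smoothMinEntropy b ε (tensorMap E F ρ) ∧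
    smoothMaxEntropy b ε ρ ≤ smoothMaxEntropy b ε (tensorMap E F ρ) := by
  obtain ⟨KE, hKE⟩ := exists_krausMap_eq hE.1
  obtain ⟨KF, hKF⟩ := exists_krausMap_eq hF.1
  obtain ⟨K, hK⟩ : ∃ K : ((A' × Fin (Fintype.card A)) × (B' × Fin (Fintype.card B))) →
      Matrix (A' × B') (A × B) ℂ, tensorMap E F = krausMap K :=
    ⟨_, by rw [hKE, hKF, tensorMap_krausMap]⟩
  have htr : ∀ ξ, (krausMap K ξ).trace = ξ.trace := fun ξ => by
    rw [← hK, trace_tensorMap hE.2 hF.2]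
  have hpos : ∀ {ξ : Matrix (A × B) (A × B) ℂ}, 0 ≤ ξ → 0 ≤ krausMap K ξ := fun h =>
    (map_zero (krausMap K)).symm.trans_le (krausMap_mono K h)
  have hρ0 : 0 ≤ ρ := Matrix.nonneg_iff_posSemidef.2 hρ.1
  have hFs : ∀ σ ∈ subStates B, F σ ∈ subStates B' := by
    intro σ hσ
    refine ⟨?_, by rw [hF.2]; exact hσ.2⟩
    rw [← Matrix.nonneg_iff_posSemidef, hKF, ← map_zero (krausMap KF)]
    exact krausMap_mono KF (Matrix.nonneg_iff_posSemidef.2 hσ.1)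
  -- Sub-unitality enters here: (1 - E(1)) ⊗ F(σ) is positive.
  have hle : ∀ σ ∈ subStates B, krausMap K ((1 : Matrix A A ℂ) ⊗ₖ σ)
      ≤ (1 : Matrix A' A' ℂ) ⊗ₖ F σ := by
    intro σ hσ
    rw [← hK, tensorMap_kronecker, Matrix.le_iff]
    have h := (Matrix.le_iff.1 hE1).kronecker (hFs σ hσ).1
    convert h using 1
    ext ⟨i, k⟩ ⟨j, l⟩
    simp [sub_mul]
  rw [hK]
  constructor
  · refine iSup₂_le fun ρ' hρ' => ?_
    have hρ'0 : 0 ≤ ρ' := Matrix.nonneg_iff_posSemidef.2 hρ'.1.1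
    have hmem : krausMap K ρ' ∈ ball ε (krausMap K ρ) := by
      refine ⟨⟨Matrix.nonneg_iff_posSemidef.1 (hpos hρ'0), by rw [htr]; exact hρ'.1.2⟩, ?_⟩
      refine (purifiedDist_le_of_traceNorm_le (traceNorm_sqrt_le_krausMap htr hρ'0 hρ0) ?_ ?_
        hρ.2).trans hρ'.2
      · rw [htr]
      · rw [htr]
    refine le_trans ?_ (le_iSup₂ (f := fun τ' _ => minEntropy b τ') _ hmem)
    refine iSup₂_le fun σ hσ => ?_
    refine le_trans ?_ (le_iSup₂ (f := fun σ' (_ : σ' ∈ subStates B') =>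
      sSup ((fun l : ℝ => (l : EReal)) ''
        {l : ℝ | krausMap K ρ' ≤ (b ^ (-l) : ℝ) • ((1 : Matrix A' A' ℂ) ⊗ₖ σ')})) _ (hFs σ hσ))
    refine sSup_le_sSup (Set.image_mono fun l hl => ?_)
    rw [Set.mem_ofPred_eq] at hl ⊢
    refine (krausMap_mono K hl).trans ?_
    have hsm : krausMap K ((b ^ (-l) : ℝ) • ((1 : Matrix A A ℂ) ⊗ₖ σ))
        = (b ^ (-l) : ℝ) • krausMap K ((1 : Matrix A A ℂ) ⊗ₖ σ) :=
      (krausMap K).map_smul_of_tower _ _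
    rw [hsm]
    have hb0 : (0 : ℝ) ≤ b ^ (-l) := by positivity
    exact smul_le_smul_of_nonneg_left (hle σ hσ) hb0
  · refine le_iInf₂ fun τ' hτ' => ?_
    have hτ'0 : 0 ≤ τ' := Matrix.nonneg_iff_posSemidef.2 hτ'.1.1
    -- ρ' depends only on τ', so one lift serves every σ in the supremum.
    obtain ⟨ρ', h0, htr', hfid, hlift⟩ := exists_lift_krausMap htr hρ0 hτ'0
    have hmem : ρ' ∈ ball ε ρ := by
      refine ⟨⟨Matrix.nonneg_iff_posSemidef.1 h0, htr'.trans hτ'.1.2⟩, ?_⟩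
      refine (purifiedDist_le_of_traceNorm_le hfid htr' (by rw [htr]) ?_).trans hτ'.2
      rw [htr]
      exact hρ.2
    refine (iInf₂_le (f := fun ρ' _ => maxEntropy b ρ') _ hmem).trans ?_
    refine iSup₂_le fun σ hσ => ?_
    refine le_trans ?_ (le_iSup₂ (f := fun σ' (_ : σ' ∈ subStates B') =>
      elogb b (fidelity τ' ((1 : Matrix A' A' ℂ) ⊗ₖ σ'))) _ (hFs σ hσ))
    have hs0 : 0 ≤ (1 : Matrix A A ℂ) ⊗ₖ σ :=
      Matrix.nonneg_iff_posSemidef.2 (Matrix.PosSemidef.one.kronecker hσ.1)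
    refine elogb_mono hb (sq_nonneg _) (pow_le_pow_left₀ (traceNorm_nonneg _) ?_ 2)
    exact (hlift _ hs0).trans (traceNorm_sqrt_mono_right hτ'0 (hpos hs0) (hle σ hσ))
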